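/- Let $X$ be a countably infinite set (with the discrete topology), and let $b:X\times X\to[0,\infty)$ be symmetric with $b(x,x)=0$ and $\sum_{y}b(x,y)<\infty$ for all $x\in X$. Assume that $(b,0)$ is connected, i.e. any two vertices are joined by a finite path $x_0,\dots,x_n$ with $b(x_{i-1},x_i)>0$. For $f:X\to\mathbb R$ let $$\widetilde Q(f)=\tfrac12\sum_{x,y\in X}b(x,y)|f(x)-f(y)|^2\in[0,\infty],\qquad \widetilde D=\{f:\widetilde Q(f)<\infty\};$$ functions in $\widetilde D$ are said to have finite energy. Let $C_c(X)$ be the space of finitely supported functions, $C_0(X)$ its closure with respect to the supremum norm, and $\widetilde D_0$ the closure of $C_c(X)$ in $\widetilde D$ with respect to the norm $\|f\|_o=(\widetilde Q(f)+|f(o)|^2)^{1/2}$, where $o\in X$ is a fixed vertex (the choice of $o$ does not matter). A function $f$ is harmonic if $\sum_y b(x,y)|f(y)|<\infty$ and $\sum_{y}b(x,y)(f(x)-f(y))=0$ for all $x\in X$. The graph is called uniformly transient if $\widetilde D_0\subseteq C_0(X)$; canonically compactifiable if every function in $\widetilde D$ is bounded; recurrent if $1\in\widetilde D_0$ and $\widetilde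 Q(1)=0$; and transient if it is not recurrent. The Royden compactification of the graph is the compact Hausdorff space $R$, unique up to homeomorphism over $X$, such that $X$ is a dense open subset of $R$, every function in $\widetilde D\cap\ell^\infty(X)$ extends uniquely to a continuous function on $R$, and these extensions separate the points of $R$. Then the following assertions are equivalent: (i) The graph $(b,0)$ is uniformly transient and every harmonic function of finite energy is constant. (ii) The graph $(b,0)$ is canonically compactifiable and every harmonic function of finite energy is constant. (iii) The graph $(b,0)$ is transient and its Royden compactification is the one-point compactification of $X$, i.e. there is a homeomorphism from $R$ onto the one-point compactification of $X$ which is the identity on $X$. -/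

import Mathlib

open scoped ENNReal

/-- A weighted graph `(b, c)` over the vertex set `X`. -/
structure WeightedGraph (X : Type*) where
  /-- the edge weight -/
  b : X → X → ℝ
  /-- the killing term -/
  c : X → ℝ
  b_nonneg : ∀ x y, 0 ≤ b x y
  b_symm : ∀ x y, b x y = b y x
  b_diag : ∀ x, b x x = 0
  b_summable : ∀ x, Summable (b x)
  c_nonneg : ∀ x, 0 ≤ c x

namespace WeightedGraph

/-- The combinatorial graph of `(b, c)`: `x` and `y` are neighbors iff `b x y > 0`. -/
def toSimpleGraph {X : Type*} (G : WeightedGraph X) : SimpleGraph X where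
  Adj x y := 0 < G.b x y
  symm := ⟨fun x y h => by rw [G.b_symm y x]; exact h⟩
  loopless := ⟨fun x h => by rw [G.b_diag x] at h; exact lt_irrefl _ h⟩

/-- Any two vertices are joined by a path of edges of positive weight. -/
def IsConnected {X : Type*} (G : WeightedGraph X) : Prop :=
  G.toSimpleGraph.Connected

/-- The generalized form `Q(f) = ½ ∑ b(x,y) |f(x) - f(y)|² + ∑ c(x) |f(x)|²` in `[0, ∞]`. -/
noncomputable def energy {X : Type*} (G : WeightedGraph X) (f : X → ℝ) : ℝ≥0∞ :=
  2⁻¹ * (∑' p : X × X, ENNReal.ofReal (G.b p.1 p.2 * |f p.1 - f p.2| ^ 2))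
    + ∑' x, ENNReal.ofReal (G.c x * |f x| ^ 2)

/-- The space `D` of functions of finite energy. -/
def finiteEnergy {X : Type*} (G : WeightedGraph X) : Set (X → ℝ) :=
  {f | G.energy f < ∞}

/-- The functions vanishing outside of a finite set (the space `C_c`). -/
def finitelySupported (X : Type*) : Set (X → ℝ) :=
  {φ | (Function.support φ).Finite}

/-- The space `C_0`: the closure of `C_c` with respect to the supremum norm. -/
def vanishingAtInfinity (X : Type*) : Set (X → ℝ) :=
  {f | ∀ ε : ℝ, 0 < ε → ∃ φ ∈ finitelySupported X, ∀ x, |f x - φ x| ≤ ε}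

/-- The bounded functions `ℓ^∞(X)`. -/
def bounded (X : Type*) : Set (X → ℝ) :=
  {f | ∃ M : ℝ, ∀ x, |f x| ≤ M}

/-- The norm `‖f‖_o = (Q(f) + |f(o)|²)^{1/2}`, with values in `[0, ∞]`. -/
noncomputable def normAt {X : Type*} (G : WeightedGraph X) (o : X) (f : X → ℝ) : ℝ≥0∞ :=
  (G.energy f + ENNReal.ofReal (|f o| ^ 2)) ^ (1 / 2 : ℝ)

/-- The space `D_0`: the closure of `C_c` in `D` with respect to `‖·‖_o`. (On a connected graph
it does not depend on the reference vertex `o`.) -/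
def finiteEnergyZero {X : Type*} (G : WeightedGraph X) (o : X) : Set (X → ℝ) :=
  {f | f ∈ G.finiteEnergy ∧
    ∀ ε : ℝ≥0∞, 0 < ε → ∃ φ ∈ finitelySupported X, G.normAt o (f - φ) < ε}

/-- Uniform transience: `D_0 ⊆ C_0`. -/
def IsUniformlyTransient {X : Type*} (G : WeightedGraph X) (o : X) : Prop :=
  G.finiteEnergyZero o ⊆ vanishingAtInfinity X

/-- Recurrence: `1 ∈ D_0` and `Q(1) = 0`. -/
def IsRecurrent {X : Type*} (G : WeightedGraph X) (o : X) : Prop :=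
  (fun _ : X => (1 : ℝ)) ∈ G.finiteEnergyZero o ∧ G.energy (fun _ => 1) = 0

/-- A graph is transient if it is not recurrent. -/
def IsTransient {X : Type*} (G : WeightedGraph X) (o : X) : Prop :=
  ¬ G.IsRecurrent o

/-- Canonical compactifiability: every function of finite energy is bounded. -/
def IsCanonicallyCompactifiable {X : Type*} (G : WeightedGraph X) : Prop :=
  G.finiteEnergy ⊆ bounded X

/-- The domain of the formal Laplacian. -/
def laplacianDomain {X : Type*} (G : WeightedGraph X) : Set (X → ℝ) :=
  {f | ∀ x, Summable fun y => G.b x y * |f y|}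

/-- The formal Laplacian (meaningful on `laplacianDomain`, where the series converges). -/
noncomputable def laplacian {X : Type*} (G : WeightedGraph X) (f : X → ℝ) (x : X) : ℝ :=
  (∑' y, G.b x y * (f x - f y)) + G.c x * f x

/-- Harmonic functions. -/
def IsHarmonic {X : Type*} (G : WeightedGraph X) (f : X → ℝ) : Prop :=
  f ∈ G.laplacianDomain ∧ ∀ x, G.laplacian f x = 0

/-- Every harmonic function of finite energy is constant. -/
def HarmonicFiniteEnergyConstant {X : Type*} (G : WeightedGraph X) : Prop :=
  ∀ f ∈ G.finiteEnergy, G.IsHarmonic f → ∃ a : ℝ, ∀ x, f x = a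

/-- The algebra `D ∩ ℓ^∞(X)` of bounded functions of finite energy. -/
def boundedFiniteEnergy {X : Type*} (G : WeightedGraph X) : Set (X → ℝ) :=
  G.finiteEnergy ∩ bounded X

/-- The defining properties of the Royden compactification `R`, where `ι : X → R` is the inclusion
of `X` (a discrete space): `R` is compact Hausdorff, `X` is open and dense in `R`, every
`f ∈ D ∩ ℓ^∞(X)` extends uniquely to a continuous function on `R`, and these extensions separate
the points of `R`. -/
structure IsRoydenCompactification {X : Type*} [TopologicalSpace X] [DiscreteTopology X]
    (G : WeightedGraph X) {R : Type*} [TopologicalSpace R] (ι : X → R) : Prop where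
  compact : CompactSpace R
  hausdorff : T2Space R
  isOpenEmbedding : Topology.IsOpenEmbedding ι
  denseRange : DenseRange ι
  extends_unique : ∀ f ∈ G.boundedFiniteEnergy, ∃! F : C(R, ℝ), ∀ x, F (ι x) = f x
  separates : ∀ r s : R, r ≠ s →
    ∃ F : C(R, ℝ), (fun x => F (ι x)) ∈ G.boundedFiniteEnergy ∧ F r ≠ F s

/-- The map sending a vertex `x` to the family `(f(x))` of values at `x` of all functions
`f ∈ D ∩ ℓ^∞(X)`. -/
def evalMap {X : Type*} (G : WeightedGraph X) (x : X) : G.boundedFiniteEnergy → ℝ :=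
  fun f => f.1 x

/-- The Royden compactification, realized as the closure of the image of `X` in the product of
copies of `ℝ` indexed by `D ∩ ℓ^∞(X)`, with the topology of pointwise convergence. Below it is
shown to have, and up to homeomorphism over `X` to be the only space having, the defining
properties. -/
abbrev RoydenCompactification {X : Type*} (G : WeightedGraph X) : Type _ :=
  closure (Set.range G.evalMap)

/-- The inclusion of `X` in its Royden compactification. -/
def toRoyden {X : Type*} (G : WeightedGraph X) (x : X) : G.RoydenCompactification :=
  ⟨G.evalMap x, subset_closure ⟨x, rfl⟩⟩

/-- The Royden compactification of `X` is the one-point compactification of the discrete space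
`X`: there is a homeomorphism between the two which is the identity on `X`. -/
def RoydenIsOnePoint {X : Type*} [TopologicalSpace X] [DiscreteTopology X]
    (G : WeightedGraph X) : Prop :=
  ∃ h : G.RoydenCompactification ≃ₜ OnePoint X, ∀ x : X, h (G.toRoyden x) = (x : OnePoint X)

theorem indicator_mem {X : Type*} (G : WeightedGraph X) (x : X) :
    Set.indicator {x} (fun _ => (1 : ℝ)) ∈ G.boundedFiniteEnergy := by
  classical
  set e : X → ℝ := Set.indicator {x} (fun _ => (1 : ℝ)) with he
  have hev : ∀ y, e y = if y = x then 1 else 0 := fun y => by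
    simp [he, Pi.single_apply]
  refine ⟨?_, 1, fun y => ?_⟩
  · have hs : ∑' z, ENNReal.ofReal (G.b x z) < ∞ := by
      rw [← ENNReal.ofReal_tsum_of_nonneg (G.b_nonneg x) (G.b_summable x)]
      exact ENNReal.ofReal_lt_top
    have h1 : ∑' p : X × X, ENNReal.ofReal (G.b p.1 p.2 * |e p.1 - e p.2| ^ 2) < ∞ := by
      have hle : ∀ p : X × X, ENNReal.ofReal (G.b p.1 p.2 * |e p.1 - e p.2| ^ 2) ≤
          (if p.1 = x then ENNReal.ofReal (G.b x p.2) else 0) +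
          (if p.2 = x then ENNReal.ofReal (G.b x p.1) else 0) := by
        rintro ⟨y, z⟩
        by_cases hy : y = x
        · by_cases hz : z = x
          · simp [hev, hy, hz]
          · simp [hev, hy, hz]
        · by_cases hz : z = x
          · simp [hev, hy, hz, G.b_symm y x]
          · simp [hev, hy, hz]
      refine lt_of_le_of_lt (ENNReal.tsum_le_tsum hle) ?_
      rw [ENNReal.tsum_add]
      refine ENNReal.add_lt_top.2 ⟨?_, ?_⟩
      · rw [ENNReal.tsum_prod', tsum_eq_single x (fun y hy => by simp [hy])]
        simpa using hs
      · rw [ENNReal.tsum_prod', ENNReal.tsum_comm, tsum_eq_single x (fun y hy => by simp [hy])]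
        simpa using hs
    have h2 : ∑' y, ENNReal.ofReal (G.c y * |e y| ^ 2) < ∞ := by
      rw [tsum_eq_single x (fun y hy => by simp [hev, hy])]
      exact ENNReal.ofReal_lt_top
    exact ENNReal.add_lt_top.2 ⟨ENNReal.mul_lt_top (by simp) h1, h2⟩
  · rw [hev]; split_ifs <;> simp

theorem isRoydenCompactification_toRoyden {X : Type*} [TopologicalSpace X] [DiscreteTopology X]
    (G : WeightedGraph X) : G.IsRoydenCompactification G.toRoyden := by
  have hdense : DenseRange G.toRoyden := by
    intro r
    rw [closure_subtype]
    have : Subtype.val '' Set.range G.toRoyden = Set.range G.evalMap := by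
      rw [← Set.range_comp]; rfl
    rw [this]; exact r.2
  have hcont : ∀ f : G.boundedFiniteEnergy,
      Continuous fun r : G.RoydenCompactification => r.1 f :=
    fun f => (continuous_apply f).comp continuous_subtype_val
  have hinj : Function.Injective G.toRoyden := by
    intro x y hxy
    have h := congrFun (congrArg Subtype.val hxy) ⟨_, G.indicator_mem x⟩
    by_contra hne
    have hne' : y ≠ x := fun h => hne h.symm
    simp [toRoyden, evalMap, hne'] at h
  have hopen : ∀ x, IsOpen ({G.toRoyden x} : Set G.RoydenCompactification) := by
    intro x
    have hU : IsOpen {r : G.RoydenCompactification |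
        r.1 ⟨_, G.indicator_mem x⟩ ≠ (0 : ℝ)} := isOpen_ne_fun (hcont _) continuous_const
    convert hU using 1
    refine Set.Subset.antisymm ?_ ?_
    · rintro r rfl
      simp [toRoyden, evalMap]
    · intro r hr
      by_contra hrx
      have hV : IsOpen ({r : G.RoydenCompactification |
        r.1 ⟨_, G.indicator_mem x⟩ ≠ (0 : ℝ)} \ {G.toRoyden x}) := hU.sdiff isClosed_singleton
      obtain ⟨y, hy1, hy2⟩ := hdense.exists_mem_open hV ⟨r, hr, hrx⟩
      have : y = x := by
        by_contra hne
        simp [toRoyden, evalMap, hne] at hy1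
      exact hy2 (by rw [this]; rfl)
  refine ⟨?_, inferInstance, ?_, hdense, ?_, ?_⟩
  · rw [← isCompact_iff_compactSpace]
    choose M hM using fun f : G.boundedFiniteEnergy => f.2.2
    have hK : IsCompact (Set.univ.pi fun f : G.boundedFiniteEnergy => Set.Icc (-M f) (M f)) :=
      isCompact_univ_pi fun f => isCompact_Icc
    refine hK.of_isClosed_subset isClosed_closure (closure_minimal ?_ hK.isClosed)
    rintro _ ⟨x, rfl⟩ f _
    exact abs_le.1 (hM f x)
  · refine Topology.IsOpenEmbedding.of_continuous_injective_isOpenMap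
      continuous_of_discreteTopology hinj fun s _ => ?_
    rw [← Set.biUnion_of_singleton s, Set.image_iUnion₂]
    refine isOpen_biUnion fun x _ => ?_
    rw [Set.image_singleton]
    exact hopen x
  · intro f hf
    refine ⟨⟨fun r => r.1 ⟨f, hf⟩, hcont _⟩, fun x => rfl, fun F hF => ?_⟩
    refine ContinuousMap.ext fun r => ?_
    refine congrFun (hdense.equalizer F.continuous (hcont ⟨f, hf⟩) ?_) r
    exact funext fun x => hF x
  · intro r s hrs
    by_contra hcon
    push Not at hcon
    exact hrs (Subtype.ext (funext fun f => hcon ⟨fun r => r.1 f, hcont f⟩ f.2))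

theorem IsRoydenCompactification.exists_homeomorph {X : Type*} [TopologicalSpace X]
    [DiscreteTopology X] {G : WeightedGraph X} {R : Type*} [TopologicalSpace R] {ι : X → R}
    (h : G.IsRoydenCompactification ι) :
    ∃ e : R ≃ₜ G.RoydenCompactification, ∀ x, e (ι x) = G.toRoyden x := by
  have hG := G.isRoydenCompactification_toRoyden
  have := h.compact
  have := h.hausdorff
  choose E hE hEu using fun f : G.boundedFiniteEnergy => h.extends_unique f.1 f.2
  have hc : Continuous fun (r : R) (f : G.boundedFiniteEnergy) => E f r :=
    continuous_pi fun f => (E f).continuous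
  have hx : ∀ x, (fun f : G.boundedFiniteEnergy => E f (ι x)) = G.evalMap x :=
    fun x => funext fun f => hE f x
  have hmem : ∀ r, (fun f : G.boundedFiniteEnergy => E f r) ∈ closure (Set.range G.evalMap) := by
    intro r
    refine h.denseRange.induction_on
      (p := fun r => (fun f : G.boundedFiniteEnergy => E f r) ∈ closure (Set.range G.evalMap))
      r (isClosed_closure.preimage hc) fun x => ?_
    rw [hx]
    exact subset_closure ⟨x, rfl⟩
  let Φ : R → G.RoydenCompactification := fun r => ⟨_, hmem r⟩
  have hΦ : Continuous Φ := hc.subtype_mk hmem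
  have hΦx : ∀ x, Φ (ι x) = G.toRoyden x := fun x => Subtype.ext (hx x)
  have hinj : Function.Injective Φ := by
    intro r s hrs
    by_contra hne
    obtain ⟨F, hF, hFne⟩ := h.separates r s hne
    have hFE : F = E ⟨_, hF⟩ := hEu ⟨_, hF⟩ F fun x => rfl
    apply hFne
    rw [hFE]
    exact congrFun (congrArg Subtype.val hrs) ⟨_, hF⟩
  have hsurj : Function.Surjective Φ := by
    rw [← Set.range_eq_univ]
    refine Set.eq_univ_of_univ_subset ?_
    rw [← hG.denseRange.closure_range]
    refine closure_minimal ?_ (isCompact_range hΦ).isClosed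
    rintro _ ⟨x, rfl⟩
    exact ⟨ι x, hΦx x⟩
  exact ⟨hΦ.homeoOfEquivCompactToT2 (f := Equiv.ofBijective Φ ⟨hinj, hsurj⟩), hΦx⟩

end WeightedGraph

namespace WeightedGraph

open Filter Topology

/-! ### The energy as a squared `ℓ²` norm -/

variable {X : Type*}

/-! Weighted differences send functions of finite energy linearly into `ℓ²(X × X)`. The energy is
the squared norm of the image, and by connectedness only constants are killed. Harmonicity becomes
orthogonality to the image of `C_c`, hence to that of `D₀`. The equivalence turns on one property:
functions of finite energy have a limit along the cofinite filter.

From (i): uniform transience forces transience because `X` is infinite, so the Royden decomposition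
`IsTransient.exists_add_harmonic` splits `f` into a part in `D₀`, which tends to `0`, and a harmonic
part, which is constant. Having a limit implies boundedness, which is (ii). For bounded functions it
says exactly that they extend to the one-point compactification, which is (iii) by
`royden_isOnePoint_iff`.

From (ii): if `u ∈ D₀` did not vanish at infinity and `φ n ∈ C_c` tended to `u` fast enough, then `∑
2 ^ n |u - φ n|` would be an unbounded function of finite energy.

From (iii): truncations of functions of finite energy have limits at infinity. In `D₀` a nonzero
limit would put `1` in `D₀`, against transience. For harmonic `f`, a truncation minus its limit lies
in `D₀`, so it is orthogonal to `f`; since the energy product of `f` with its truncation dominates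
the energy of the truncation, the latter is constant. -/

/-- The weighted difference operator, `f ↦ √(b(x,y)/2) (f(x) - f(y))`. -/
noncomputable def edgeDiff (G : WeightedGraph X) : (X → ℝ) →ₗ[ℝ] (X × X → ℝ) where
  toFun f p := √(G.b p.1 p.2 / 2) * (f p.1 - f p.2)
  map_add' f g := by ext p; simp only [Pi.add_apply]; ring
  map_smul' a f := by ext p; simp only [Pi.smul_apply, smul_eq_mul, RingHom.id_apply]; ring

theorem edgeDiff_apply (G : WeightedGraph X) (f : X → ℝ) (p : X × X) :
    G.edgeDiff f p = √(G.b p.1 p.2 / 2) * (f p.1 - f p.2) := rfl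

theorem edgeDiff_sq (G : WeightedGraph X) (f : X → ℝ) (p : X × X) :
    G.edgeDiff f p ^ 2 = G.b p.1 p.2 / 2 * (f p.1 - f p.2) ^ 2 := by
  rw [edgeDiff_apply, mul_pow, Real.sq_sqrt (div_nonneg (G.b_nonneg _ _) zero_le_two)]

theorem edgeDiff_mul (G : WeightedGraph X) (f g : X → ℝ) (p : X × X) :
    G.edgeDiff f p * G.edgeDiff g p
      = G.b p.1 p.2 / 2 * ((f p.1 - f p.2) * (g p.1 - g p.2)) := by
  rw [edgeDiff_apply, edgeDiff_apply]
  have := Real.mul_self_sqrt (div_nonneg (G.b_nonneg p.1 p.2) zero_le_two)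
  linear_combination ((f p.1 - f p.2) * (g p.1 - g p.2)) * this

theorem abs_edgeDiff_le (G : WeightedGraph X) {f g : X → ℝ}
    (h : ∀ x y, |f x - f y| ≤ |g x - g y|) (p : X × X) :
    |G.edgeDiff f p| ≤ |G.edgeDiff g p| := by
  rw [edgeDiff_apply, edgeDiff_apply, abs_mul, abs_mul]
  exact mul_le_mul_of_nonneg_left (h _ _) (abs_nonneg _)

theorem edgeDiff_sq_le (G : WeightedGraph X) {f g : X → ℝ}
    (h : ∀ x y, |f x - f y| ≤ |g x - g y|) (p : X × X) :
    G.edgeDiff f p ^ 2 ≤ G.edgeDiff g p ^ 2 :=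
  sq_le_sq.2 (G.abs_edgeDiff_le h p)

theorem edgeDiff_const (G : WeightedGraph X) (a : ℝ) : G.edgeDiff (fun _ => a) = 0 := by
  ext p; simp [edgeDiff_apply]

theorem energy_eq_tsum (G : WeightedGraph X) (hc : ∀ x, G.c x = 0) (f : X → ℝ) :
    G.energy f = ∑' p, ENNReal.ofReal (G.edgeDiff f p ^ 2) := by
  simp only [energy, hc, zero_mul, ENNReal.ofReal_zero, tsum_zero, add_zero]
  rw [← ENNReal.tsum_mul_left]
  refine tsum_congr fun p => ?_
  rw [edgeDiff_sq, sq_abs, div_mul_eq_mul_div, div_eq_inv_mul,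
    ENNReal.ofReal_mul (p := 2⁻¹) (by norm_num), ENNReal.ofReal_inv_of_pos two_pos,
    ENNReal.ofReal_ofNat]

theorem memlp_two_iff {ι : Type*} {f : ι → ℝ} : Memℓp f 2 ↔ Summable fun i => f i ^ 2 := by
  rw [memℓp_gen_iff (by norm_num)]
  simp

theorem mem_finiteEnergy_iff (G : WeightedGraph X) (hc : ∀ x, G.c x = 0) {f : X → ℝ} :
    f ∈ G.finiteEnergy ↔ Memℓp (G.edgeDiff f) 2 := by
  rw [memlp_two_iff]
  change G.energy f < ∞ ↔ _
  rw [G.energy_eq_tsum hc, lt_top_iff_ne_top]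
  refine ⟨fun h => ?_, fun h => h.tsum_ofReal_ne_top⟩
  simpa [ENNReal.toReal_ofReal, sq_nonneg] using ENNReal.summable_toReal h

/-- The functions of finite energy as a vector space. -/
def energySpace (G : WeightedGraph X) : Submodule ℝ (X → ℝ) where
  carrier := {f | Memℓp (G.edgeDiff f) 2}
  add_mem' {f g} hf hg := by
    change Memℓp (G.edgeDiff (f + g)) 2
    rw [map_add]; exact Memℓp.add hf hg
  zero_mem' := by
    change Memℓp (G.edgeDiff 0) 2
    rw [map_zero]; exact zero_memℓp
  smul_mem' a f hf := by
    change Memℓp (G.edgeDiff (a • f)) 2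
    rw [map_smul]; exact Memℓp.const_smul hf a

theorem mem_energySpace (G : WeightedGraph X) {f : X → ℝ} :
    f ∈ G.energySpace ↔ Summable fun p => G.edgeDiff f p ^ 2 := memlp_two_iff

theorem mem_finiteEnergy (G : WeightedGraph X) (hc : ∀ x, G.c x = 0) {f : X → ℝ} :
    f ∈ G.finiteEnergy ↔ f ∈ G.energySpace := G.mem_finiteEnergy_iff hc

theorem mem_energySpace_of_le (G : WeightedGraph X) {f g : X → ℝ} (hg : g ∈ G.energySpace)
    (h : ∀ x y, |f x - f y| ≤ |g x - g y|) : f ∈ G.energySpace :=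
  G.mem_energySpace.2 <| (G.mem_energySpace.1 hg).of_nonneg_of_le (fun _ => sq_nonneg _)
    (G.edgeDiff_sq_le h)

theorem const_mem_energySpace (G : WeightedGraph X) (a : ℝ) : (fun _ => a) ∈ G.energySpace := by
  refine G.mem_energySpace.2 ?_
  rw [edgeDiff_const]
  simp

/-- The difference operator on the functions of finite energy, with values in `ℓ²`. -/
noncomputable def toLp (G : WeightedGraph X) :
    G.energySpace →ₗ[ℝ] lp (fun _ : X × X => ℝ) 2 where
  toFun f := ⟨G.edgeDiff f, f.2⟩
  map_add' f g := by
    ext p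
    exact congrFun (map_add G.edgeDiff f.1 g.1) p
  map_smul' a f := by
    ext p
    exact congrFun (map_smul G.edgeDiff a f.1) p

theorem toLp_apply (G : WeightedGraph X) (f : G.energySpace) (p : X × X) :
    G.toLp f p = G.edgeDiff f p := rfl

theorem norm_sq_toLp (G : WeightedGraph X) (f : G.energySpace) :
    ‖G.toLp f‖ ^ 2 = ∑' p, G.edgeDiff f p ^ 2 := by
  have := lp.norm_rpow_eq_tsum (p := 2) (by norm_num) (G.toLp f)
  simpa [toLp_apply] using this

theorem inner_toLp (G : WeightedGraph X) (f g : G.energySpace) :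
    inner ℝ (G.toLp f) (G.toLp g) = ∑' p, G.edgeDiff f p * G.edgeDiff g p := by
  rw [lp.inner_eq_tsum]
  refine tsum_congr fun p => ?_
  rw [toLp_apply, toLp_apply, real_inner_eq_re_inner]
  simp [mul_comm]

theorem energy_eq_norm (G : WeightedGraph X) (hc : ∀ x, G.c x = 0) (f : G.energySpace) :
    G.energy f = ENNReal.ofReal (‖G.toLp f‖ ^ 2) := by
  rw [norm_sq_toLp, G.energy_eq_tsum hc, ENNReal.ofReal_tsum_of_nonneg (fun _ => sq_nonneg _)]
  exact G.mem_energySpace.1 f.2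

/-! ### Finitely supported functions -/

theorem indicator_mem_energySpace (G : WeightedGraph X) (hc : ∀ x, G.c x = 0) (x : X) :
    Set.indicator {x} (fun _ => (1 : ℝ)) ∈ G.energySpace :=
  (G.mem_finiteEnergy hc).1 (G.indicator_mem x).1

theorem eq_sum_indicator {φ : X → ℝ} (hφ : φ ∈ finitelySupported X) :
    φ = ∑ x ∈ Set.Finite.toFinset hφ, φ x • Set.indicator {x} (fun _ => (1 : ℝ)) := by
  classical
  ext y
  simp only [Finset.sum_apply, Pi.smul_apply, smul_eq_mul, Set.indicator_apply,
    Set.mem_singleton_iff, mul_ite, mul_one, mul_zero]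
  rw [Finset.sum_ite_eq]
  split_ifs with h
  · rfl
  · by_contra h0
    exact h ((Set.Finite.mem_toFinset hφ).2 h0)

theorem finitelySupported_subset (G : WeightedGraph X) (hc : ∀ x, G.c x = 0) {φ : X → ℝ}
    (hφ : φ ∈ finitelySupported X) : φ ∈ G.energySpace := by
  rw [eq_sum_indicator hφ]
  exact Submodule.sum_mem _ fun x _ => Submodule.smul_mem _ _ (G.indicator_mem_energySpace hc x)

/-- The finitely supported functions as a subspace of the functions of finite energy. -/
def finitelySupportedSubmodule (G : WeightedGraph X) : Submodule ℝ G.energySpace where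
  carrier := {φ | (φ : X → ℝ) ∈ finitelySupported X}
  add_mem' {f g} hf hg := by
    refine (Set.Finite.union hf hg).subset ?_
    exact Function.support_add _ _
  zero_mem' := by
    change (Function.support (fun _ : X => (0 : ℝ))).Finite
    simp
  smul_mem' a f hf := by
    refine Set.Finite.subset hf ?_
    exact Function.support_const_smul_subset _ _

theorem mem_vanishingAtInfinity_iff {f : X → ℝ} :
    f ∈ vanishingAtInfinity X ↔ Tendsto f cofinite (𝓝 0) := by
  rw [Metric.tendsto_nhds]
  constructor
  · intro h ε hε
    obtain ⟨φ, hφ, hle⟩ := h (ε / 2) (half_pos hε)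
    refine (Set.Finite.subset hφ fun x hx => ?_ :)
    intro h0
    have := hle x
    rw [h0, sub_zero] at this
    refine hx ?_
    change dist (f x) 0 < ε
    rw [Real.dist_0_eq_abs]; linarith
  · intro h ε hε
    refine ⟨Set.indicator {x | ε ≤ |f x|} f, ?_, fun x => ?_⟩
    · refine Set.Finite.subset (h ε hε) (fun x hx => ?_)
      simpa [Real.dist_0_eq_abs] using Set.support_indicator_subset hx
    · by_cases hx : ε ≤ |f x|
      · rw [Set.indicator_of_mem (by exact hx)]; simpa using hε.le
      · rw [Set.indicator_of_notMem (by exact hx), sub_zero]; exact (not_le.1 hx).le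

theorem tendsto_cofinite_bounded {f : X → ℝ} {a : ℝ} (h : Tendsto f cofinite (𝓝 a)) :
    f ∈ bounded X := by
  have hfin : {x | ¬ |f x| < |a| + 1}.Finite :=
    h.abs.eventually (gt_mem_nhds (lt_add_one |a|))
  obtain ⟨M, hM⟩ := (hfin.image fun x => |f x|).bddAbove
  refine ⟨max M (|a| + 1), fun x => ?_⟩
  by_cases hx : |f x| < |a| + 1
  · exact hx.le.trans (le_max_right _ _)
  · exact (hM ⟨x, hx, rfl⟩).trans (le_max_left _ _)

/-! ### Point evaluations -/

/-- Telescope along a path from `x` to `o`: each edge increment is one coordinate of the `ℓ²` vector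
divided by the positive weight `√(b/2)`. This turns energy convergence into pointwise convergence.
-/
theorem exists_eval_le (G : WeightedGraph X) (hG : G.IsConnected) (o x : X) :
    ∃ C : ℝ, 0 ≤ C ∧ ∀ f : G.energySpace, |f.1 x - f.1 o| ≤ C * ‖G.toLp f‖ := by
  obtain ⟨w⟩ := hG.preconnected x o
  induction w with
  | nil => exact ⟨0, le_rfl, fun f => by simp⟩
  | @cons u v w h _ ih =>
    obtain ⟨C, hC, hf⟩ := ih
    have hb : 0 < √(G.b u v / 2) := Real.sqrt_pos.2 (half_pos h)
    refine ⟨(√(G.b u v / 2))⁻¹ + C, by positivity, fun f => ?_⟩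
    have h1 : |f.1 u - f.1 v| ≤ (√(G.b u v / 2))⁻¹ * ‖G.toLp f‖ := by
      have := lp.norm_apply_le_norm (p := 2) (by norm_num) (G.toLp f) (u, v)
      rw [toLp_apply, edgeDiff_apply, Real.norm_eq_abs, abs_mul, abs_of_pos hb] at this
      rwa [inv_mul_eq_div, le_div_iff₀' hb]
    calc |f.1 u - f.1 w| ≤ |f.1 u - f.1 v| + |f.1 v - f.1 w| := abs_sub_le _ _ _
      _ ≤ _ := by rw [add_mul]; exact add_le_add h1 (hf f)

/-! ### The space `D₀` -/

theorem normAt_lt_iff (G : WeightedGraph X) (hc : ∀ x, G.c x = 0) (o : X) (f : G.energySpace)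
    {ε : ℝ} (hε : 0 < ε) :
    G.normAt o f < ENNReal.ofReal ε ↔ ‖G.toLp f‖ ^ 2 + |f.1 o| ^ 2 < ε ^ 2 := by
  rw [normAt, G.energy_eq_norm hc, ← ENNReal.ofReal_add (by positivity) (by positivity),
    one_div, ENNReal.rpow_inv_lt_iff two_pos, ENNReal.ofReal_rpow_of_pos hε,
    ENNReal.ofReal_lt_ofReal_iff (by positivity)]
  norm_num

theorem mem_finiteEnergyZero_iff (G : WeightedGraph X) (hc : ∀ x, G.c x = 0) (o : X)
    (f : G.energySpace) :
    f.1 ∈ G.finiteEnergyZero o ↔ ∀ ε : ℝ, 0 < ε → ∃ φ ∈ G.finitelySupportedSubmodule,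
      ‖G.toLp (f - φ)‖ < ε ∧ |f.1 o - φ.1 o| < ε := by
  constructor
  · rintro ⟨-, h⟩ ε hε
    obtain ⟨φ, hφ, hlt⟩ := h (ENNReal.ofReal ε) (ENNReal.ofReal_pos.2 hε)
    let ψ : G.energySpace := ⟨φ, G.finitelySupported_subset hc hφ⟩
    have h1 := (G.normAt_lt_iff hc o (f - ψ) hε).1 hlt
    refine ⟨ψ, hφ, ?_, ?_⟩
    · exact lt_of_pow_lt_pow_left₀ 2 hε.le (by linarith [sq_nonneg |(f - ψ).1 o|])
    · exact lt_of_pow_lt_pow_left₀ 2 hε.le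
        (lt_of_le_of_lt (le_add_of_nonneg_left (sq_nonneg _)) h1)
  · intro h
    refine ⟨(G.mem_finiteEnergy hc).2 f.2, fun ε hε => ?_⟩
    obtain ⟨δ, hδ, hδε⟩ : ∃ δ : ℝ, 0 < δ ∧ ENNReal.ofReal δ ≤ ε := by
      by_cases ht : ε = ∞
      · exact ⟨1, one_pos, by simp [ht]⟩
      · exact ⟨ε.toReal, ENNReal.toReal_pos hε.ne' ht, (ENNReal.ofReal_toReal ht).le⟩
    -- Half of `δ` suffices for both terms, since `2 (δ / 2) ^ 2 < δ ^ 2`.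
    obtain ⟨φ, hφ, h1, h2⟩ := h (δ / 2) (half_pos hδ)
    refine ⟨φ.1, hφ, lt_of_lt_of_le ?_ hδε⟩
    refine (G.normAt_lt_iff hc o (f - φ) hδ).2 ?_
    have h3 := pow_lt_pow_left₀ h1 (norm_nonneg _) two_ne_zero
    have h4 := pow_lt_pow_left₀ h2 (abs_nonneg _) two_ne_zero
    change _ + |f.1 o - φ.1 o| ^ 2 < _
    nlinarith

/-- Sequential form of membership in `D₀`. -/
theorem mem_finiteEnergyZero_iff_seq (G : WeightedGraph X) (hc : ∀ x, G.c x = 0) (o : X)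
    (f : G.energySpace) :
    f.1 ∈ G.finiteEnergyZero o ↔ ∃ φ : ℕ → G.energySpace,
      (∀ n, φ n ∈ G.finitelySupportedSubmodule) ∧
      Tendsto (fun n => ‖G.toLp (φ n - f)‖) atTop (𝓝 0) ∧
      Tendsto (fun n => (φ n).1 o) atTop (𝓝 (f.1 o)) := by
  rw [G.mem_finiteEnergyZero_iff hc]
  constructor
  · intro h
    choose φ hφ h1 h2 using fun n : ℕ => h (1 / ((n : ℝ) + 1)) Nat.one_div_pos_of_nat
    refine ⟨φ, hφ, ?_, ?_⟩
    · refine squeeze_zero (fun _ => norm_nonneg _) (fun n => ?_)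
        tendsto_one_div_add_atTop_nhds_zero_nat
      rw [← neg_sub, map_neg, norm_neg]
      exact (h1 n).le
    · refine tendsto_iff_dist_tendsto_zero.2 <| squeeze_zero (fun _ => dist_nonneg) (fun n => ?_)
        tendsto_one_div_add_atTop_nhds_zero_nat
      rw [dist_comm]
      exact (h2 n).le
  · rintro ⟨φ, hφ, h1, h2⟩ ε hε
    obtain ⟨n, hn1, hn2⟩ := ((h1.eventually (gt_mem_nhds hε)).and
      (Metric.tendsto_nhds.1 h2 ε hε)).exists
    refine ⟨φ n, hφ n, ?_, ?_⟩
    · rw [← neg_sub, map_neg, norm_neg]; exact hn1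
    · rw [dist_comm] at hn2; exact hn2

theorem tendsto_eval (G : WeightedGraph X) (hG : G.IsConnected) {o : X} {f : G.energySpace}
    {φ : ℕ → G.energySpace} (h1 : Tendsto (fun n => ‖G.toLp (φ n - f)‖) atTop (𝓝 0))
    (h2 : Tendsto (fun n => (φ n).1 o) atTop (𝓝 (f.1 o))) (x : X) :
    Tendsto (fun n => (φ n).1 x) atTop (𝓝 (f.1 x)) := by
  obtain ⟨C, -, hC⟩ := G.exists_eval_le hG o x
  have h3 : Tendsto (fun n => (φ n - f).1 x - (φ n - f).1 o) atTop (𝓝 0) :=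
    squeeze_zero_norm (fun n => hC _) (by simpa using h1.const_mul C)
  have h4 : Tendsto (fun n => (φ n).1 o + f.1 x - f.1 o + ((φ n - f).1 x - (φ n - f).1 o))
      atTop (𝓝 (f.1 o + f.1 x - f.1 o + 0)) :=
    ((h2.add_const _).sub_const _).add h3
  refine (h4.congr fun n => ?_).trans_eq (by ring_nf)
  simp only [Submodule.coe_sub, Pi.sub_apply]; ring

/-! ### Contractions, truncations and linear operations in `D₀` -/

/-- Dominated convergence for series with a varying bound `u n + v`, where `∑ u n → 0`. -/
theorem tendsto_tsum_zero_of_le_add {ι : Type*} {a u : ℕ → ι → ℝ} {v : ι → ℝ}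
    (ha : ∀ n i, 0 ≤ a n i) (hu : ∀ n i, 0 ≤ u n i) (hle : ∀ n i, a n i ≤ u n i + v i)
    (hus : ∀ n, Summable (u n)) (hv : Summable v)
    (hut : Tendsto (fun n => ∑' i, u n i) atTop (𝓝 0))
    (hat : ∀ i, Tendsto (fun n => a n i) atTop (𝓝 0)) :
    Tendsto (fun n => ∑' i, a n i) atTop (𝓝 0) := by
  have has : ∀ n, Summable (a n) := fun n =>
    ((hus n).add hv).of_nonneg_of_le (ha n) (hle n)
  have hbd : ∀ n i, ‖max (a n i - u n i) 0‖ ≤ |v i| := fun n i => by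
    rw [Real.norm_of_nonneg (le_max_right _ _)]
    exact max_le ((sub_le_iff_le_add'.2 (hle n i)).trans (le_abs_self _)) (abs_nonneg _)
  have hms : ∀ n, Summable fun i => max (a n i - u n i) 0 := fun n =>
    Summable.of_norm_bounded hv.abs (hbd n)
  -- The excess of `a n` over `u n` is dominated by the fixed summable `|v|`, so ordinary dominated
  -- convergence applies to it; the rest is at most `u n`, whose sum tends to `0`.
  have hmt : Tendsto (fun n => ∑' i, max (a n i - u n i) 0) atTop (𝓝 (∑' _ : ι, (0 : ℝ))) := by
    refine tendsto_tsum_of_dominated_convergence hv.abs (fun i => ?_)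
      (Eventually.of_forall fun n i => hbd n i)
    exact squeeze_zero (fun n => le_max_right _ _)
      (fun n => max_le (sub_le_self _ (hu n i)) (ha n i)) (hat i)
  rw [tsum_zero] at hmt
  refine squeeze_zero (fun n => tsum_nonneg (ha n)) (fun n => ?_) (by simpa using hut.add hmt)
  rw [← (hus n).tsum_add (hms n)]
  exact (has n).tsum_le_tsum (fun i => by linarith [le_max_left (a n i - u n i) 0])
    ((hus n).add (hms n))

/-- Composition with a `1`-Lipschitz function. -/
def contraction (G : WeightedGraph X) (T : ℝ → ℝ) (hT : ∀ s t, |T s - T t| ≤ |s - t|)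
    (f : G.energySpace) : G.energySpace :=
  ⟨fun x => T (f.1 x), G.mem_energySpace_of_le f.2 fun _ _ => hT _ _⟩

theorem continuous_of_contraction {T : ℝ → ℝ} (hT : ∀ s t, |T s - T t| ≤ |s - t|) :
    Continuous T :=
  (LipschitzWith.of_dist_le_mul (K := 1) fun s t => by simpa [Real.dist_eq] using hT s t).continuous

theorem tendsto_edgeDiff (G : WeightedGraph X) {f : ℕ → X → ℝ} {g : X → ℝ}
    (h : ∀ x, Tendsto (fun n => f n x) atTop (𝓝 (g x))) (p : X × X) :
    Tendsto (fun n => G.edgeDiff (f n) p) atTop (𝓝 (G.edgeDiff g p)) :=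
  ((h p.1).sub (h p.2)).const_mul _

theorem tendsto_norm_toLp_iff (G : WeightedGraph X) {f : ℕ → G.energySpace} :
    Tendsto (fun n => ‖G.toLp (f n)‖) atTop (𝓝 0) ↔
      Tendsto (fun n => ∑' p, G.edgeDiff (f n).1 p ^ 2) atTop (𝓝 0) := by
  simp only [← norm_sq_toLp]
  constructor
  · intro h; simpa using h.pow 2
  · intro h
    have := (Real.continuous_sqrt.tendsto 0).comp h
    simpa [Function.comp_def, Real.sqrt_sq] using this

/-- Composition with `T` is not linear, so `T ∘ φ n - T ∘ f` is not controlled by `φ n - f` alone.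
Pointwise convergence together with a majorant built from `φ n - f` and `f` gives the limit instead.
-/
theorem tendsto_toLp_contraction (G : WeightedGraph X) {T : ℝ → ℝ}
    (hT : ∀ s t, |T s - T t| ≤ |s - t|) {f : G.energySpace} {φ : ℕ → G.energySpace}
    (h1 : Tendsto (fun n => ‖G.toLp (φ n - f)‖) atTop (𝓝 0))
    (h2 : ∀ x, Tendsto (fun n => (φ n).1 x) atTop (𝓝 (f.1 x))) :
    Tendsto (fun n => ‖G.toLp (G.contraction T hT (φ n) - G.contraction T hT f)‖) atTop (𝓝 0) := by
  rw [tendsto_norm_toLp_iff] at h1 ⊢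
  -- With `d`, `e` the differences of `φ n`, `f`, the summand is at most `2 d² + 2 e²`, and `d² ≤ 2
  -- (d - e)² + 2 e²`; this gives the constants 4 and 6.
  refine tendsto_tsum_zero_of_le_add (u := fun n p => 4 * G.edgeDiff (φ n - f).1 p ^ 2)
    (v := fun p => 6 * G.edgeDiff f.1 p ^ 2) (fun _ _ => sq_nonneg _)
    (fun _ _ => mul_nonneg (by norm_num) (sq_nonneg _)) (fun n p => ?_)
    (fun n => (G.mem_energySpace.1 (φ n - f).2).mul_left 4)
    ((G.mem_energySpace.1 f.2).mul_left 6) ?_ fun p => ?_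
  · have e1 := G.edgeDiff_sq_le (f := (G.contraction T hT (φ n)).1) (g := (φ n).1)
      (fun _ _ => hT _ _) p
    have e2 := G.edgeDiff_sq_le (f := (G.contraction T hT f).1) (g := f.1) (fun _ _ => hT _ _) p
    simp only [Submodule.coe_sub, map_sub, Pi.sub_apply] at e1 e2 ⊢
    nlinarith [sq_nonneg (G.edgeDiff (G.contraction T hT (φ n)).1 p
      + G.edgeDiff (G.contraction T hT f).1 p),
      sq_nonneg (G.edgeDiff (φ n).1 p - 2 * G.edgeDiff f.1 p)]
  · simp only [tsum_mul_left]
    simpa using h1.const_mul 4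
  · have h3 := G.tendsto_edgeDiff (f := fun n => (G.contraction T hT (φ n)).1)
      (fun x => ((continuous_of_contraction hT).tendsto _).comp (h2 x)) p
    have h4 := (h3.sub_const (G.edgeDiff (G.contraction T hT f).1 p)).pow 2
    have h5 : G.edgeDiff (G.contraction T hT f).1 p = G.edgeDiff (fun x => T (f.1 x)) p := rfl
    rw [h5, sub_self, zero_pow two_ne_zero] at h4
    simpa only [Submodule.coe_sub, map_sub, Pi.sub_apply, h5] using h4

theorem contraction_mem_finiteEnergyZero (G : WeightedGraph X) (hc : ∀ x, G.c x = 0)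
    (hG : G.IsConnected) {o : X} {T : ℝ → ℝ} (hT : ∀ s t, |T s - T t| ≤ |s - t|) (hT0 : T 0 = 0)
    {f : G.energySpace} (hf : f.1 ∈ G.finiteEnergyZero o) :
    (G.contraction T hT f).1 ∈ G.finiteEnergyZero o := by
  obtain ⟨φ, hφ, h1, h2⟩ := (G.mem_finiteEnergyZero_iff_seq hc o f).1 hf
  refine (G.mem_finiteEnergyZero_iff_seq hc o _).2
    ⟨fun n => G.contraction T hT (φ n), fun n => ?_,
      G.tendsto_toLp_contraction hT h1 (G.tendsto_eval hG h1 h2),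
      ((continuous_of_contraction hT).tendsto _).comp h2⟩
  refine Set.Finite.subset (hφ n) fun x hx hx0 => hx ?_
  change T ((φ n).1 x) = 0
  rw [hx0, hT0]

theorem sub_mem_finiteEnergyZero (G : WeightedGraph X) (hc : ∀ x, G.c x = 0) {o : X}
    {f g : G.energySpace} (hf : f.1 ∈ G.finiteEnergyZero o) (hg : g.1 ∈ G.finiteEnergyZero o) :
    (f - g).1 ∈ G.finiteEnergyZero o := by
  obtain ⟨φ, hφ, h1, h2⟩ := (G.mem_finiteEnergyZero_iff_seq hc o f).1 hf
  obtain ⟨ψ, hψ, h3, h4⟩ := (G.mem_finiteEnergyZero_iff_seq hc o g).1 hg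
  refine (G.mem_finiteEnergyZero_iff_seq hc o _).2
    ⟨fun n => φ n - ψ n, fun n => sub_mem (hφ n) (hψ n), ?_, h2.sub h4⟩
  refine squeeze_zero (fun _ => norm_nonneg _) (fun n => ?_) (by simpa only [add_zero] using h1.add h3)
  rw [show φ n - ψ n - (f - g) = (φ n - f) - (ψ n - g) by abel, map_sub G.toLp (φ n - f)]
  exact norm_sub_le (G.toLp (φ n - f)) (G.toLp (ψ n - g))

theorem smul_mem_finiteEnergyZero (G : WeightedGraph X) (hc : ∀ x, G.c x = 0) {o : X}
    {f : G.energySpace} (a : ℝ) (hf : f.1 ∈ G.finiteEnergyZero o) :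
    (a • f).1 ∈ G.finiteEnergyZero o := by
  obtain ⟨φ, hφ, h1, h2⟩ := (G.mem_finiteEnergyZero_iff_seq hc o f).1 hf
  refine (G.mem_finiteEnergyZero_iff_seq hc o _).2
    ⟨fun n => a • φ n, fun n => Submodule.smul_mem _ a (hφ n), ?_, h2.const_mul a⟩
  have : ∀ n, ‖G.toLp (a • φ n - a • f)‖ = ‖a‖ * ‖G.toLp (φ n - f)‖ := fun n => by
    rw [← smul_sub a (φ n) f, map_smul, norm_smul]
  simp only [this]
  simpa only [mul_zero] using h1.const_mul ‖a‖

theorem abs_clamp_sub_le (r s t : ℝ) :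
    |max (-r) (min r s) - max (-r) (min r t)| ≤ |s - t| := by
  refine (abs_max_sub_max_le_max _ _ _ _).trans (max_le (by simp) ?_)
  exact (abs_min_sub_min_le_max _ _ _ _).trans (max_le (by simp) le_rfl)

theorem abs_clamp_le {r : ℝ} (hr : 0 ≤ r) (s : ℝ) : |max (-r) (min r s)| ≤ r :=
  abs_le.2 ⟨le_max_left _ _, max_le (by linarith) (min_le_left _ _)⟩

theorem clamp_eq_self {r s : ℝ} (h : |s| ≤ r) : max (-r) (min r s) = s := by
  rw [min_eq_right (abs_le.1 h).2, max_eq_right (abs_le.1 h).1]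

/-- Functions of finite energy vanishing at infinity belong to `D₀`. -/
theorem mem_finiteEnergyZero_of_tendsto (G : WeightedGraph X) (hc : ∀ x, G.c x = 0) {o : X}
    {f : G.energySpace} (hf : Tendsto f.1 cofinite (𝓝 0)) : f.1 ∈ G.finiteEnergyZero o := by
  let r : ℕ → ℝ := fun n => 1 / ((n : ℝ) + 1)
  have hr : ∀ n, 0 < r n := fun n => Nat.one_div_pos_of_nat
  have hr0 : Tendsto r atTop (𝓝 0) := tendsto_one_div_add_atTop_nhds_zero_nat
  let g : ℕ → G.energySpace := fun n =>
    G.contraction (fun s => max (-r n) (min (r n) s)) (abs_clamp_sub_le (r n)) f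
  have hg : ∀ x, Tendsto (fun n => (g n).1 x) atTop (𝓝 0) := fun x =>
    squeeze_zero_norm (fun n => abs_clamp_le (hr n).le _) hr0
  refine (G.mem_finiteEnergyZero_iff_seq hc o _).2 ⟨fun n => f - g n, fun n => ?_, ?_, ?_⟩
  -- Subtracting the truncation at level `r n` leaves a function supported where `|f| ≥ r n`, a
  -- finite set because `f` vanishes at infinity.
  · have hfin : {x | ¬ |f.1 x| < r n}.Finite := by
      have := (hf.abs).eventually (gt_mem_nhds (by simpa using hr n : |(0 : ℝ)| < r n))
      exact this
    refine Set.Finite.subset hfin fun x hx hlt => hx ?_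
    change f.1 x - max (-r n) (min (r n) (f.1 x)) = 0
    rw [clamp_eq_self (le_of_lt hlt), sub_self]
  · have : ∀ n, ‖G.toLp (f - g n - f)‖ = ‖G.toLp (g n)‖ := fun n => by
      rw [show f - g n - f = -g n by abel, map_neg, norm_neg]
    simp only [this]
    rw [tendsto_norm_toLp_iff]
    refine tendsto_tsum_zero_of_le_add (u := fun _ _ => 0) (v := fun p => G.edgeDiff f.1 p ^ 2)
      (fun _ _ => sq_nonneg _) (fun _ _ => le_rfl) (fun n p => ?_) (fun _ => summable_zero)
      (G.mem_energySpace.1 f.2) (by simp) fun p => ?_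
    · rw [zero_add]
      exact G.edgeDiff_sq_le (fun _ _ => abs_clamp_sub_le _ _ _) p
    · have := (G.tendsto_edgeDiff hg p).pow 2
      simpa [edgeDiff_apply] using this
  · simpa using (hg o).const_sub (f.1 o)

/-- The constant function `1` does not belong to `D₀` on a transient graph. -/
theorem IsTransient.one_notMem {G : WeightedGraph X} (hc : ∀ x, G.c x = 0) {o : X}
    (h : G.IsTransient o) : (fun _ : X => (1 : ℝ)) ∉ G.finiteEnergyZero o := fun h1 =>
  h ⟨h1, by rw [G.energy_eq_tsum hc, edgeDiff_const]; simp⟩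

/-! ### Canonical compactifiability and uniform transience -/

/-- A series of functions of finite energy converges pointwise to a function of finite energy as
soon as the series of the norms converges. -/
theorem tsum_mem_energySpace (G : WeightedGraph X) (hG : G.IsConnected) {o : X}
    {g : ℕ → G.energySpace} (h1 : Summable fun n => ‖G.toLp (g n)‖)
    (h2 : Summable fun n => |(g n).1 o|) :
    (∀ x, Summable fun n => |(g n).1 x|) ∧ (fun x => ∑' n, (g n).1 x) ∈ G.energySpace := by
  have hs : ∀ x, Summable fun n => |(g n).1 x| := fun x => by
    obtain ⟨C, -, hC⟩ := G.exists_eval_le hG o x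
    refine (h2.add (h1.mul_left C)).of_nonneg_of_le (fun _ => abs_nonneg _) fun n => ?_
    have e1 := abs_sub_abs_le_abs_sub ((g n).1 x) ((g n).1 o)
    linarith [hC (g n)]
  refine ⟨hs, ?_⟩
  have hw := (Summable.of_norm h1).hasSum
  set w := ∑' n, G.toLp (g n) with hwdef
  have hp : ∀ p, w p = G.edgeDiff (fun x => ∑' n, (g n).1 x) p := fun p => by
    have e1 := hw.mapL (lp.evalCLM ℝ (fun _ : X × X => ℝ) 2 p)
    have e2 : HasSum (fun n => G.edgeDiff (g n).1 p)
        (G.edgeDiff (fun x => ∑' n, (g n).1 x) p) :=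
      (((hs p.1).of_abs.hasSum).sub ((hs p.2).of_abs.hasSum)).mul_left _
    exact e1.unique e2
  change Memℓp (G.edgeDiff fun x => ∑' n, (g n).1 x) 2
  rw [← funext hp]
  exact w.2

/-- Canonically compactifiable graphs are uniformly transient. -/
theorem IsCanonicallyCompactifiable.isUniformlyTransient {G : WeightedGraph X}
    (hc : ∀ x, G.c x = 0) (hG : G.IsConnected) (o : X) (h : G.IsCanonicallyCompactifiable) :
    G.IsUniformlyTransient o := by
  intro u hu
  rw [mem_vanishingAtInfinity_iff]
  let f : G.energySpace := ⟨u, (G.mem_finiteEnergy hc).1 hu.1⟩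
  by_contra hcon
  obtain ⟨ε, hε, hinf⟩ : ∃ ε : ℝ, 0 < ε ∧ {x | ε ≤ |u x|}.Infinite := by
    rw [Metric.tendsto_nhds] at hcon
    push Not at hcon
    obtain ⟨ε, hε, hx⟩ := hcon
    refine ⟨ε, hε, fun hfin => hx ?_⟩
    refine Set.Finite.subset hfin fun x hx => ?_
    simpa [Real.dist_0_eq_abs] using hx
  -- Errors of size `4⁻ⁿ` leave room for the weights `2 ^ n`: the weighted norms are summable, while
  -- the weights still force the sum to be unbounded.
  choose φ hφ hφ1 hφ2 using fun n : ℕ =>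
    (G.mem_finiteEnergyZero_iff hc o f).1 hu ((1 / 4 : ℝ) ^ n) (by positivity)
  let g : ℕ → G.energySpace := fun n =>
    (2 : ℝ) ^ n • G.contraction (fun s => |s|) (fun s t => abs_abs_sub_abs_le s t) (f - φ n)
  have hgx : ∀ n x, (g n).1 x = 2 ^ n * |u x - (φ n).1 x| := fun n x => rfl
  have hpow : ∀ n : ℕ, (2 : ℝ) ^ n * (1 / 4) ^ n = (1 / 2) ^ n := fun n => by
    rw [← mul_pow]; norm_num
  have hsum : Summable fun n : ℕ => (1 / 2 : ℝ) ^ n := summable_geometric_two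
  obtain ⟨hs, hmem⟩ := G.tsum_mem_energySpace hG (o := o) (g := g)
    (hsum.of_nonneg_of_le (fun _ => norm_nonneg _) fun n => by
      rw [map_smul, norm_smul, ← hpow, Real.norm_of_nonneg (by positivity)]
      refine mul_le_mul_of_nonneg_left (le_trans ?_ (hφ1 n).le) (by positivity)
      refine le_of_sq_le_sq ?_ (norm_nonneg _)
      rw [norm_sq_toLp, norm_sq_toLp]
      exact Summable.tsum_le_tsum (G.edgeDiff_sq_le fun x y => abs_abs_sub_abs_le _ _)
        (G.mem_energySpace.1 (Subtype.prop _)) (G.mem_energySpace.1 (Subtype.prop _)))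
    (hsum.of_nonneg_of_le (fun _ => abs_nonneg _) fun n => by
      rw [hgx, ← hpow, abs_of_nonneg (by positivity)]
      exact mul_le_mul_of_nonneg_left (hφ2 n).le (by positivity))
  obtain ⟨M, hM⟩ := h ((G.mem_finiteEnergy hc).2 hmem)
  obtain ⟨n, hn⟩ := pow_unbounded_of_one_lt (M / ε) (one_lt_two (α := ℝ))
  -- Off the finite support of `φ n`, the `n`-th term alone is `2 ^ n |u x| ≥ 2 ^ n ε > M`, and the
  -- other terms are nonnegative.
  obtain ⟨x, hx1, hx2⟩ := (hinf.sdiff (hφ n)).nonempty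
  have hx0 : (φ n).1 x = 0 := by simpa using hx2
  have h1 : (g n).1 x ≤ ∑' n, (g n).1 x :=
    (hs x).of_abs.le_tsum n fun m _ => by rw [hgx]; positivity
  have h2 := (le_abs_self _).trans (hM x)
  rw [hgx, hx0, sub_zero] at h1
  rw [div_lt_iff₀ hε] at hn
  have h3 : (2 : ℝ) ^ n * ε ≤ 2 ^ n * |u x| := mul_le_mul_of_nonneg_left hx1 (by positivity)
  linarith

/-! ### Harmonic functions and the Royden decomposition -/

theorem energySpace_subset_laplacianDomain (G : WeightedGraph X) (f : G.energySpace) :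
    f.1 ∈ G.laplacianDomain := by
  intro x
  have h1 : Summable fun y => G.edgeDiff f.1 (x, y) ^ 2 :=
    (G.mem_energySpace.1 f.2).comp_injective (Prod.mk_right_injective x)
  refine (((G.b_summable x).mul_left (|f.1 x| + 1)).add (h1.mul_left 2)).of_nonneg_of_le
    (fun y => mul_nonneg (G.b_nonneg _ _) (abs_nonneg _)) fun y => ?_
  rw [edgeDiff_sq]
  -- From `t ≤ 1 + t²`; the constant part is summable against `b x` and the square against the
  -- energy.
  have h2 : |f.1 y| ≤ |f.1 x| + 1 + (f.1 x - f.1 y) ^ 2 := by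
    have e1 := abs_sub_abs_le_abs_sub (f.1 y) (f.1 x)
    rw [abs_sub_comm, ← sq_abs] at *
    nlinarith [sq_nonneg (|f.1 x - f.1 y| - 1), abs_nonneg (f.1 x - f.1 y)]
  have h3 := mul_le_mul_of_nonneg_left h2 (G.b_nonneg x y)
  linarith

/-- Green's formula for a point mass. Pairs with first coordinate `z` and pairs with second
coordinate `z` each contribute half; the pair `(z, z)`, counted twice, contributes zero. -/
theorem inner_toLp_indicator (G : WeightedGraph X) (hc : ∀ x, G.c x = 0) (f : G.energySpace)
    (z : X) :
    inner ℝ (G.toLp f) (G.toLp ⟨_, G.indicator_mem_energySpace hc z⟩) = G.laplacian f.1 z := by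
  classical
  rw [inner_toLp]
  have hs : Summable fun y => G.b z y * (f.1 z - f.1 y) := by
    have h1 := (G.b_summable z).mul_right (f.1 z)
    have h2 : Summable fun y => G.b z y * f.1 y := by
      refine Summable.of_norm ?_
      simpa [abs_mul, abs_of_nonneg (G.b_nonneg _ _)] using
        G.energySpace_subset_laplacianDomain f z
    simpa only [mul_sub] using h1.sub h2
  set S := ∑' y, G.b z y * (f.1 z - f.1 y) with hS
  have h1 : HasSum (fun p : X × X => if p.1 = z then G.b p.1 p.2 / 2 * (f.1 p.1 - f.1 p.2) else 0)
      (S / 2) := by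
    rw [← (Prod.mk_right_injective z).hasSum_iff]
    · refine (hs.hasSum.div_const 2).congr_fun ?_
      intro y
      simp only [Function.comp_apply, if_true]
      ring
    · rintro ⟨x, y⟩ hxy
      refine if_neg fun h => hxy ⟨y, ?_⟩
      simp only at h
      rw [h]
  have h2 : HasSum (fun p : X × X => if p.2 = z then G.b p.1 p.2 / 2 * (f.1 p.2 - f.1 p.1) else 0)
      (S / 2) := by
    rw [← (Prod.mk_left_injective z).hasSum_iff]
    · refine (hs.hasSum.div_const 2).congr_fun ?_
      intro y
      simp only [Function.comp_apply, if_true, G.b_symm y z]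
      ring
    · rintro ⟨x, y⟩ hxy
      refine if_neg fun h => hxy ⟨x, ?_⟩
      simp only at h
      rw [h]
  have h3 := h1.add h2
  rw [add_halves] at h3
  rw [laplacian, hc, zero_mul, add_zero, ← hS, ← h3.tsum_eq]
  refine tsum_congr fun p => ?_
  rw [edgeDiff_mul]
  simp only [Set.indicator_apply, Set.mem_singleton_iff]
  split_ifs <;> ring

theorem isHarmonic_iff_inner_eq_zero (G : WeightedGraph X) (hc : ∀ x, G.c x = 0)
    (f : G.energySpace) :
    G.IsHarmonic f.1 ↔
      ∀ φ ∈ G.finitelySupportedSubmodule, inner ℝ (G.toLp f) (G.toLp φ) = 0 := by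
  constructor
  · rintro ⟨-, h⟩ φ hφ
    have : φ = ∑ x ∈ Set.Finite.toFinset hφ,
        φ.1 x • (⟨_, G.indicator_mem_energySpace hc x⟩ : G.energySpace) := by
      refine Subtype.ext ?_
      rw [Submodule.coe_sum]
      exact eq_sum_indicator hφ
    rw [this, map_sum, inner_sum]
    refine Finset.sum_eq_zero fun x _ => ?_
    rw [map_smul, inner_smul_right, G.inner_toLp_indicator hc, h, mul_zero]
  · intro h
    refine ⟨G.energySpace_subset_laplacianDomain f, fun x => ?_⟩
    rw [← G.inner_toLp_indicator hc]
    refine h _ ?_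
    exact (Set.finite_singleton x).subset Set.support_indicator_subset

/-- Harmonic functions are orthogonal to `D₀`. -/
theorem IsHarmonic.inner_eq_zero {G : WeightedGraph X} (hc : ∀ x, G.c x = 0) {o : X}
    {f u : G.energySpace} (hf : G.IsHarmonic f.1) (hu : u.1 ∈ G.finiteEnergyZero o) :
    inner ℝ (G.toLp f) (G.toLp u) = 0 := by
  obtain ⟨φ, hφ, h1, -⟩ := (G.mem_finiteEnergyZero_iff_seq hc o u).1 hu
  have h2 : Tendsto (fun n => G.toLp (φ n)) atTop (𝓝 (G.toLp u)) := by
    rw [tendsto_iff_norm_sub_tendsto_zero]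
    simpa only [map_sub] using h1
  have h3 := (tendsto_const_nhds (x := G.toLp f)).inner (𝕜 := ℝ) h2
  refine tendsto_nhds_unique h3 (tendsto_const_nhds.congr fun n => ?_)
  exact ((G.isHarmonic_iff_inner_eq_zero hc f).1 hf _ (hφ n)).symm

/-- Without such a bound at `o`, finitely supported functions normalized to `1` at `o` could have
arbitrarily small energy and would approximate the constant `1`. The bound at `o` moves to `x` by
connectedness. -/
theorem IsTransient.exists_eval_le {G : WeightedGraph X} (hc : ∀ x, G.c x = 0)
    (hG : G.IsConnected) {o : X} (h : G.IsTransient o) (x : X) :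
    ∃ C : ℝ, 0 ≤ C ∧ ∀ φ ∈ G.finitelySupportedSubmodule, |φ.1 x| ≤ C * ‖G.toLp φ‖ := by
  obtain ⟨C, hC0, hC⟩ : ∃ C : ℝ, 0 ≤ C ∧ ∀ φ ∈ G.finitelySupportedSubmodule,
      |φ.1 o| ≤ C * ‖G.toLp φ‖ := by
    by_contra! hcon
    refine h.one_notMem hc
      ((G.mem_finiteEnergyZero_iff hc o ⟨_, G.const_mem_energySpace 1⟩).2 fun ε hε => ?_)
    obtain ⟨φ, hφ, hlt⟩ := hcon ε⁻¹ (inv_nonneg.2 hε.le)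
    have hpos : 0 < |φ.1 o| := lt_of_le_of_lt (by positivity) hlt
    refine ⟨(φ.1 o)⁻¹ • φ, Submodule.smul_mem _ _ hφ, ?_, ?_⟩
    · have h0 : G.toLp ⟨_, G.const_mem_energySpace 1⟩ = 0 := by
        ext p
        rw [toLp_apply, edgeDiff_const]; rfl
      rw [map_sub, h0, zero_sub, norm_neg, map_smul, norm_smul, norm_inv, Real.norm_eq_abs,
        inv_mul_lt_iff₀ hpos]
      rwa [inv_mul_lt_iff₀ hε, mul_comm] at hlt
    · change |1 - (φ.1 o)⁻¹ * φ.1 o| < ε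
      rwa [inv_mul_cancel₀ (abs_pos.1 hpos), sub_self, abs_zero]
  obtain ⟨C', hC0', hC'⟩ := G.exists_eval_le hG o x
  refine ⟨C' + C, add_nonneg hC0' hC0, fun φ hφ => ?_⟩
  have := abs_sub_abs_le_abs_sub (φ.1 x) (φ.1 o)
  linarith [hC φ hφ, hC' φ]

/-- The Royden decomposition on a transient graph. -/
theorem IsTransient.exists_add_harmonic {G : WeightedGraph X} (hc : ∀ x, G.c x = 0)
    (hG : G.IsConnected) {o : X} (h : G.IsTransient o) (f : G.energySpace) :
    ∃ u v : G.energySpace, u.1 ∈ G.finiteEnergyZero o ∧ G.IsHarmonic v.1 ∧ f = u + v := by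
  let V : Submodule ℝ (lp (fun _ : X × X => ℝ) 2) := G.finitelySupportedSubmodule.map G.toLp
  have hcl : IsClosed (V.topologicalClosure : Set (lp (fun _ : X × X => ℝ) 2)) :=
    V.isClosed_topologicalClosure
  have : CompleteSpace V.topologicalClosure := hcl.completeSpace_coe
  -- Project onto the closure of the image of `C_c`. The projection `k` is so far only an `ℓ²`
  -- vector; transience makes the approximating functions converge pointwise, and `k` is the
  -- difference of their limit `u`.
  obtain ⟨k, hk, w, hw, hkw⟩ :=
    Submodule.exists_add_mem_mem_orthogonal (K := V.topologicalClosure) (G.toLp f)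
  obtain ⟨s, hsV, hsk⟩ := mem_closure_iff_seq_limit.1 hk
  choose φ hφ hφs using hsV
  have hcauchy : ∀ x, CauchySeq fun n => (φ n).1 x := fun x => by
    obtain ⟨C, hC0, hC⟩ := h.exists_eval_le hc hG x
    refine Metric.cauchySeq_iff.2 fun ε hε => ?_
    obtain ⟨N, hN⟩ := Metric.cauchySeq_iff.1 hsk.cauchySeq (ε / (C + 1)) (by positivity)
    refine ⟨N, fun m hm n hn => ?_⟩
    have h1 := hC _ (sub_mem (hφ m) (hφ n))
    rw [map_sub, hφs, hφs, ← dist_eq_norm] at h1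
    have h2 := hN m hm n hn
    rw [lt_div_iff₀ (by positivity)] at h2
    change |(φ m).1 x - (φ n).1 x| < ε
    change |(φ m).1 x - (φ n).1 x| ≤ _ at h1
    linarith [dist_nonneg (x := s m) (y := s n)]
  choose u hu using fun x => cauchySeq_tendsto_of_complete (hcauchy x)
  have hku : ∀ p, k p = G.edgeDiff u p := fun p => by
    have h1 := ((lp.evalCLM ℝ (fun _ : X × X => ℝ) 2 p).continuous.tendsto k).comp hsk
    refine tendsto_nhds_unique h1 ((G.tendsto_edgeDiff hu p).congr fun n => ?_)
    change _ = s n p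
    rw [← hφs, toLp_apply]
  have humem : u ∈ G.energySpace := by
    change Memℓp (G.edgeDiff u) 2
    rw [← funext hku]
    exact k.2
  have hJu : G.toLp ⟨u, humem⟩ = k := by
    ext p; rw [hku, toLp_apply]
  refine ⟨⟨u, humem⟩, f - ⟨u, humem⟩, ?_, ?_, by abel⟩
  · refine (G.mem_finiteEnergyZero_iff_seq hc o ⟨u, humem⟩).2 ⟨φ, hφ, ?_, hu o⟩
    rw [tendsto_iff_norm_sub_tendsto_zero] at hsk
    simpa only [map_sub, hJu, hφs] using hsk
  · refine (G.isHarmonic_iff_inner_eq_zero hc _).2 fun ψ hψ => ?_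
    rw [map_sub, hJu, hkw, add_sub_cancel_left]
    exact Submodule.inner_left_of_mem_orthogonal
      (V.le_topologicalClosure (Submodule.mem_map_of_mem hψ)) hw

/-! ### Limits at infinity and the Royden compactification -/

theorem not_tendsto_const_zero [Infinite X] {a : ℝ} (ha : a ≠ 0) :
    ¬ Tendsto (fun _ : X => a) cofinite (𝓝 0) := fun h =>
  ha (tendsto_nhds_unique tendsto_const_nhds h)

theorem IsUniformlyTransient.isTransient [Infinite X] {G : WeightedGraph X} {o : X}
    (h : G.IsUniformlyTransient o) : G.IsTransient o := fun hr =>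
  not_tendsto_const_zero one_ne_zero (mem_vanishingAtInfinity_iff.1 (h hr.1))

theorem IsUniformlyTransient.exists_tendsto [Infinite X] {G : WeightedGraph X}
    (hc : ∀ x, G.c x = 0) (hG : G.IsConnected) {o : X} (h : G.IsUniformlyTransient o)
    (hH : G.HarmonicFiniteEnergyConstant) {f : X → ℝ} (hf : f ∈ G.finiteEnergy) :
    ∃ a, Tendsto f cofinite (𝓝 a) := by
  obtain ⟨u, v, hu, hv, huv⟩ :=
    h.isTransient.exists_add_harmonic hc hG ⟨f, (G.mem_finiteEnergy hc).1 hf⟩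
  obtain ⟨a, ha⟩ := hH v.1 ((G.mem_finiteEnergy hc).2 v.2) hv
  refine ⟨a, ?_⟩
  have h1 := (mem_vanishingAtInfinity_iff.1 (h hu)).add_const a
  rw [zero_add] at h1
  refine h1.congr fun x => ?_
  rw [← ha x]
  exact (congrFun (congrArg Subtype.val huv) x).symm

/-- A function on the discrete space `X` extends continuously to `OnePoint X` exactly when it
converges along `cofinite`. Point masses have finite energy and separate points, so once all
extensions exist, uniqueness of the Royden compactification identifies the two spaces. -/
theorem royden_isOnePoint_iff [Infinite X] [TopologicalSpace X] [DiscreteTopology X]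
    (G : WeightedGraph X) :
    G.RoydenIsOnePoint ↔ ∀ f ∈ G.boundedFiniteEnergy, ∃ a, Tendsto f cofinite (𝓝 a) := by
  constructor
  · rintro ⟨e, he⟩ f hf
    obtain ⟨F, hF, -⟩ := G.isRoydenCompactification_toRoyden.extends_unique f hf
    refine ⟨F (e.symm OnePoint.infty), ?_⟩
    have h1 := (OnePoint.continuous_iff_from_discrete (fun z => F (e.symm z))).1
      (F.continuous.comp e.symm.continuous)
    refine h1.congr fun x => ?_
    rw [← he, e.symm_apply_apply, hF]
  · intro h
    -- Noncompactness makes `X` dense in `OnePoint X`.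
    have : NoncompactSpace X :=
      not_compactSpace_iff.1 fun _ => not_finite_iff_infinite.2 ‹_› finite_of_compact_of_discrete
    have hr : G.IsRoydenCompactification (OnePoint.some : X → OnePoint X) := by
      refine ⟨inferInstance, inferInstance, OnePoint.isOpenEmbedding_coe,
        OnePoint.denseRange_coe, fun f hf => ?_, ?_⟩
      · obtain ⟨a, ha⟩ := h f hf
        refine ⟨⟨fun z => z.elim a f, ?_⟩, fun x => rfl, fun F hF => ?_⟩
        · exact (OnePoint.continuous_iff_from_discrete _).2 ha
        · refine ContinuousMap.ext fun z => congrFun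
            (OnePoint.denseRange_coe.equalizer F.continuous (ContinuousMap.continuous _) ?_) z
          exact funext hF
      · have hsep : ∀ (x : X) (s : OnePoint X), s ≠ x → ∃ F : C(OnePoint X, ℝ),
            (fun y : X => F y) ∈ G.boundedFiniteEnergy ∧ F x ≠ F s := by
          intro x s hs
          have hcont : Continuous fun z : OnePoint X =>
              z.elim (0 : ℝ) (Set.indicator {x} fun _ => (1 : ℝ)) := by
            refine (OnePoint.continuous_iff_from_discrete _).2 ?_
            refine mem_vanishingAtInfinity_iff.1 fun ε hε =>
              ⟨Set.indicator {x} fun _ => (1 : ℝ), ?_, fun y => ?_⟩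
            · exact (Set.finite_singleton x).subset
                (Set.support_indicator_subset (f := fun _ => (1 : ℝ)))
            · change |Set.indicator {x} (fun _ => (1 : ℝ)) y - _| ≤ ε
              rw [sub_self, abs_zero]; exact hε.le
          refine ⟨⟨_, hcont⟩, G.indicator_mem x, ?_⟩
          induction s using OnePoint.rec with
          | infty => simp
          | coe y =>
            have : y ≠ x := fun h => hs (by rw [h])
            simp [this]
        intro r s hrs
        induction r using OnePoint.rec with
        | coe x => exact hsep x s hrs.symm
        | infty =>
          induction s using OnePoint.rec with
          | infty => exact absurd rfl hrs
          | coe y =>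
            obtain ⟨F, hF, hne⟩ := hsep y _ hrs
            exact ⟨F, hF, hne.symm⟩
    obtain ⟨e, he⟩ := hr.exists_homeomorph
    exact ⟨e.symm, fun x => by rw [← he, e.symm_apply_apply]⟩

/-! ### Consequences of the existence of limits at infinity -/

/-- On a transient graph, the only possible limit at infinity of a function in `D₀` is `0`. -/
theorem IsTransient.tendsto_zero {G : WeightedGraph X} (hc : ∀ x, G.c x = 0) {o : X}
    (h : G.IsTransient o) {u : G.energySpace} (hu : u.1 ∈ G.finiteEnergyZero o) {a : ℝ}
    (ha : Tendsto u.1 cofinite (𝓝 a)) : a = 0 := by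
  by_contra hne
  let k : G.energySpace := ⟨_, G.const_mem_energySpace a⟩
  have h1 : (u - k).1 ∈ G.finiteEnergyZero o := by
    refine G.mem_finiteEnergyZero_of_tendsto hc ?_
    have := ha.sub_const a
    rwa [sub_self] at this
  -- The constant `a` is `u - (u - a)`, a difference of two elements of `D₀`; dividing by `a` puts
  -- `1` in `D₀`.
  have h2 := G.smul_mem_finiteEnergyZero hc a⁻¹ (G.sub_mem_finiteEnergyZero hc hu h1)
  rw [sub_sub_cancel] at h2
  refine h.one_notMem hc ?_
  convert h2 using 1
  ext x
  exact (inv_mul_cancel₀ hne).symm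

/-- Limits are available only for bounded functions, so `f ∈ D₀` is truncated at level `1`, which
stays in `D₀` and therefore tends to `0`. Where the truncation is below `1` in modulus it equals
`f`. -/
theorem IsTransient.isUniformlyTransient {G : WeightedGraph X} (hc : ∀ x, G.c x = 0)
    (hG : G.IsConnected) {o : X} (h : G.IsTransient o)
    (hlim : ∀ f ∈ G.boundedFiniteEnergy, ∃ a, Tendsto f cofinite (𝓝 a)) :
    G.IsUniformlyTransient o := by
  intro f hf
  let u : G.energySpace := ⟨f, (G.mem_finiteEnergy hc).1 hf.1⟩
  let v := G.contraction (fun s => max (-1) (min 1 s)) (abs_clamp_sub_le 1) u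
  have hv : v.1 ∈ G.finiteEnergyZero o :=
    G.contraction_mem_finiteEnergyZero hc hG (abs_clamp_sub_le 1) (by simp) (f := u) hf
  obtain ⟨a, ha⟩ := hlim v.1 ⟨hv.1, 1, fun x => abs_clamp_le zero_le_one _⟩
  rw [h.tendsto_zero hc hv ha] at ha
  rw [mem_vanishingAtInfinity_iff]
  refine ha.congr' ?_
  filter_upwards [ha.abs.eventually (gt_mem_nhds (by simp : |(0 : ℝ)| < 1))] with x hx
  refine clamp_eq_self (le_of_lt (lt_of_not_ge fun hge => ?_))
  rcases le_abs.1 hge with h1 | h1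
  · have : v.1 x = 1 := by
      change max (-1) (min 1 (f x)) = 1
      rw [min_eq_left h1]; norm_num
    rw [this] at hx; norm_num at hx
  · have : v.1 x = -1 := by
      change max (-1) (min 1 (f x)) = -1
      rw [max_eq_left ((min_le_right _ _).trans (by linarith))]
    rw [this] at hx; norm_num at hx

theorem eq_of_norm_toLp_eq_zero (G : WeightedGraph X) (hG : G.IsConnected) {f : G.energySpace}
    (h : ‖G.toLp f‖ = 0) (x y : X) : f.1 x = f.1 y := by
  obtain ⟨C, -, hC⟩ := G.exists_eval_le hG y x
  have := hC f
  rw [h, mul_zero] at this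
  exact sub_eq_zero.1 (abs_nonpos_iff.1 this)

/-- Truncation is monotone and `1`-Lipschitz, so its increments have the sign of `s - t` and no
larger modulus. Summed over edges, this bounds the energy of a truncation by its energy product with
the function. -/
theorem sq_clamp_sub_le (r s t : ℝ) :
    (max (-r) (min r s) - max (-r) (min r t)) ^ 2
      ≤ (s - t) * (max (-r) (min r s) - max (-r) (min r t)) := by
  have h1 := abs_clamp_sub_le r s t
  have hm : Monotone fun s : ℝ => max (-r) (min r s) := fun a b hab =>
    max_le_max le_rfl (min_le_min le_rfl hab)
  rcases le_total s t with h | h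
  · have h2 := sub_nonpos.2 (hm h)
    rw [abs_of_nonpos h2, abs_of_nonpos (sub_nonpos.2 h)] at h1
    nlinarith
  · have h2 := sub_nonneg.2 (hm h)
    rw [abs_of_nonneg h2, abs_of_nonneg (sub_nonneg.2 h)] at h1
    nlinarith

theorem harmonicFiniteEnergyConstant_of_tendsto {G : WeightedGraph X} (hc : ∀ x, G.c x = 0)
    (hG : G.IsConnected) (o : X)
    (hlim : ∀ f ∈ G.boundedFiniteEnergy, ∃ a, Tendsto f cofinite (𝓝 a)) :
    G.HarmonicFiniteEnergyConstant := by
  intro f hf hharm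
  let u : G.energySpace := ⟨f, (G.mem_finiteEnergy hc).1 hf⟩
  refine ⟨f o, fun x => ?_⟩
  -- This level leaves the values at `x` and `o` unchanged, so constancy of the truncation gives `f
  -- x = f o`.
  let r := max |f x| |f o|
  have hr : 0 ≤ r := (abs_nonneg _).trans (le_max_left _ _)
  let v := G.contraction (fun s => max (-r) (min r s)) (abs_clamp_sub_le r) u
  obtain ⟨a, ha⟩ := hlim v.1 ⟨(G.mem_finiteEnergy hc).2 v.2, r, fun x => abs_clamp_le hr _⟩
  let k : G.energySpace := ⟨_, G.const_mem_energySpace a⟩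
  have hk : G.toLp k = 0 := by
    ext p
    rw [toLp_apply, edgeDiff_const]; rfl
  have h1 : (v - k).1 ∈ G.finiteEnergyZero o := by
    refine G.mem_finiteEnergyZero_of_tendsto hc ?_
    have := ha.sub_const a
    rwa [sub_self] at this
  -- Constants have zero difference, so orthogonality of `f` to `v - a` is orthogonality to `v`
  -- itself.
  have h2 := IsHarmonic.inner_eq_zero (f := u) hc hharm h1
  rw [map_sub, hk, sub_zero] at h2
  have h3 : ‖G.toLp v‖ ^ 2 ≤ 0 := by
    rw [← h2, inner_toLp, norm_sq_toLp]
    have hsum : Summable fun p => G.edgeDiff u.1 p * G.edgeDiff v.1 p :=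
      lp.summable_inner (𝕜 := ℝ) (G.toLp v) (G.toLp u)
    refine (G.mem_energySpace.1 v.2).tsum_le_tsum (fun p => ?_) hsum
    rw [edgeDiff_sq, edgeDiff_mul]
    exact mul_le_mul_of_nonneg_left (sq_clamp_sub_le r _ _)
      (div_nonneg (G.b_nonneg _ _) zero_le_two)
  have h4 := G.eq_of_norm_toLp_eq_zero hG (pow_eq_zero_iff two_ne_zero |>.1
    (le_antisymm h3 (sq_nonneg _))) x o
  change max (-r) (min r (f x)) = max (-r) (min r (f o)) at h4
  rwa [clamp_eq_self (le_max_left _ _), clamp_eq_self (le_max_right _ _)] at h4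

end WeightedGraph

/-! ### The equivalence -/

theorem theorem6p2 {X : Type*} [Countable X] [Infinite X] [TopologicalSpace X]
    [DiscreteTopology X] (G : WeightedGraph X) (hc : ∀ x, G.c x = 0) (hG : G.IsConnected)
    (o : X) :
    List.TFAE
      [G.IsUniformlyTransient o ∧ G.HarmonicFiniteEnergyConstant,
       G.IsCanonicallyCompactifiable ∧ G.HarmonicFiniteEnergyConstant,
       G.IsTransient o ∧ G.RoydenIsOnePoint] := by
  tfae_have 1 → 2 := fun ⟨h, hH⟩ => ⟨fun f hf =>
    (h.exists_tendsto hc hG hH hf).elim fun _ ha => WeightedGraph.tendsto_cofinite_bounded ha, hH⟩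
  tfae_have 2 → 1 := fun ⟨h, hH⟩ => ⟨h.isUniformlyTransient hc hG o, hH⟩
  tfae_have 1 → 3 := fun ⟨h, hH⟩ => ⟨h.isTransient,
    G.royden_isOnePoint_iff.2 fun f hf => h.exists_tendsto hc hG hH hf.1⟩
  tfae_have 3 → 1 := fun ⟨h, hR⟩ =>
    ⟨h.isUniformlyTransient hc hG (G.royden_isOnePoint_iff.1 hR),
      WeightedGraph.harmonicFiniteEnergyConstant_of_tendsto hc hG o
        (G.royden_isOnePoint_iff.1 hR)⟩
  tfae_finish
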